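/- Let $W_{YZ|X}$ be a memoryless broadcast channel with finite nonempty input alphabet $\mathcal X$ and finite output alphabets $\mathcal Y,\mathcal Z$. An $(n,K)$ consensus code consists of an encoder $f:[1:K]\to\mathcal X^n$ and decoders $g_B:\mathcal Y^n\to[1:K]\cup\{\perp\}$, $g_C:\mathcal Z^n\to[1:K]\cup\{\perp\}$. Its error probability is $$P_e=\max\Big(\max_{m}\big(1-\Pr(g_B(Y^n)=g_C(Z^n)=m\mid X^n=f(m))\big),\ \max_{x^n\in\mathcal X^n}\Pr(g_B(Y^n)\ne g_C(Z^n)\mid X^n=x^n)\Big).$$ A rate $R\ge 0$ is achievable with consensus if there is $\epsilon>0$ such that for all sufficiently large $n$ there is an $(n,\lfloor 2^{nR}\rfloor)$ consensus code with $P_e\le 2^{-n\epsilon}$. The consensus capacity $C_{\mathrm{Byz}}$ is the supremum of all rates achievable with consensus. The characteristic graph of $W_{YZ|X}$ is the bipartite graph on the disjoint union $\mathcal Y\sqcup\mathcal Z$ in which $y\in\mathcal Y$ and $z\in\mathcal Z$ are joined if and only if $W_{YZ|X}(y,z|x)>0$ for some $x\in\mathcal X$. Let $\mathcal V$ be the set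 of its connected components. The common channel is the point-to-point channel $W_{V|X}(v|x)=\sum_{\{y,z\}\text{ an edge of }v}W_{YZ|X}(y,z|x)$ from $\mathcal X$ to $\mathcal V$, and $C_{\text{p-to-p}}(W_{V|X})=\max_{P_X}I(X;V)$ (in bits) is its capacity. An effective input alphabet is a set $\mathcal U\subseteq\mathcal X$ that contains exactly one letter $u$ with $W_{V|X}(\cdot|u)=w$ for each vertex $w$ of the convex hull of $\{W_{V|X}(\cdot|x):x\in\mathcal X\}$, and no other letters. Then the supremum defining $C_{\mathrm{Byz}}$ is that of a nonempty bounded set, the maximum defining $C_{\text{p-to-p}}(W_{V|X})$ is attained, and: 1. if $C_{\text{p-to-p}}(W_{V|X})=0$, then every effective input alphabet $\mathcal U$ is a singleton and $C_{\mathrm{Byz}}=0$; 2. $C_{\mathrm{Byz}}\ge C_{\text{p-to-p}}(W_{V|X})$; 3. consequently, $C_{\mathrm{Byz}}>0$ if and only if $C_{\text{p-to-p}}(W_{V|X})>0$. -/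

import Mathlib

namespace Consensus

/-- A discrete memoryless channel from the alphabet `A` to the finite alphabet `B`:
`W.prob a b` is the probability of the output `b` when the input is `a`. -/
structure Channel (A B : Type*) [Fintype B] where
  prob : A → B → ℝ
  nonneg : ∀ a b, 0 ≤ prob a b
  sum_eq_one : ∀ a, ∑ b, prob a b = 1

/-! ### Point-to-point channels -/

/-- Mutual information, in bits, of a joint probability mass function `J` on `A × B`
(terms with `J a b = 0` contribute `0`). -/
noncomputable def mutualInfo {A B : Type*} [Fintype A] [Fintype B] (J : A → B → ℝ) : ℝ :=
  ∑ a, ∑ b, J a b * Real.logb 2 (J a b / ((∑ b', J a b') * (∑ a', J a' b)))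

/-- The values `I(A;B)` when the input distribution `P` ranges over all probability mass
functions on `A` and `B` is the output of the channel `W`. -/
def mutualInfoValues {A B : Type*} [Fintype A] [Fintype B] (W : Channel A B) : Set ℝ :=
  (fun P : A → ℝ => mutualInfo fun a b => P a * W.prob a b) '' stdSimplex ℝ A

/-- The point-to-point capacity `max_P I(A;B)`, in bits per channel use. -/
noncomputable def capacity {A B : Type*} [Fintype A] [Fintype B] (W : Channel A B) : ℝ :=
  sSup (mutualInfoValues W)

section Broadcast

variable {X Y Z : Type*} [Fintype Y] [Fintype Z]

/-! ### Consensus codes and consensus capacity -/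

/-- An `(n, K)` consensus code; `none` is the symbol `⊥`. -/
structure Code (X Y Z : Type*) (n K : ℕ) where
  enc : Fin K → (Fin n → X)
  decB : (Fin n → Y) → Option (Fin K)
  decC : (Fin n → Z) → Option (Fin K)

open Classical in
/-- `Pr ((Yⁿ, Zⁿ) ∈ E | Xⁿ = x)` for the memoryless broadcast channel `W`. -/
noncomputable def prOut (W : Channel X (Y × Z)) {n : ℕ} (x : Fin n → X)
    (E : Set ((Fin n → Y) × (Fin n → Z))) : ℝ :=
  ∑ o : (Fin n → Y) × (Fin n → Z), if o ∈ E then ∏ i, W.prob (x i) (o.1 i, o.2 i) else 0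

/-- `λ_m`: an honest sender transmits the codeword of `m`, and some decoder does not output `m`. -/
noncomputable def honestError (W : Channel X (Y × Z)) {n K : ℕ} (c : Code X Y Z n K)
    (m : Fin K) : ℝ :=
  1 - prOut W (c.enc m) {o | c.decB o.1 = some m ∧ c.decC o.2 = some m}

/-- `η_x`: the word `x` is transmitted, and the two decoder outputs differ. -/
noncomputable def disagreement (W : Channel X (Y × Z)) {n K : ℕ} (c : Code X Y Z n K)
    (x : Fin n → X) : ℝ :=
  prOut W x {o | c.decB o.1 ≠ c.decC o.2}

/-- The error probability `max (max_m λ_m) (max_x η_x)`. -/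
noncomputable def errorProb (W : Channel X (Y × Z)) {n K : ℕ} (c : Code X Y Z n K) : ℝ :=
  max (⨆ m, honestError W c m) (⨆ x, disagreement W c x)

/-- The rate `R` is achievable with consensus. -/
def Achievable (W : Channel X (Y × Z)) (R : ℝ) : Prop :=
  0 ≤ R ∧ ∃ ε : ℝ, 0 < ε ∧ ∀ᶠ n : ℕ in Filter.atTop,
    ∃ c : Code X Y Z n ⌊(2 : ℝ) ^ ((n : ℝ) * R)⌋₊,
      errorProb W c ≤ (2 : ℝ) ^ (-((n : ℝ) * ε))

/-- The consensus capacity: the supremum of all rates achievable with consensus. -/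
noncomputable def consensusCapacity (W : Channel X (Y × Z)) : ℝ :=
  sSup {R | Achievable W R}

/-! ### The common channel -/

/-- The characteristic graph: the bipartite graph on the disjoint union of `Y` and `Z` in which
`y` and `z` are joined when `W(y,z|x) > 0` for some input letter `x`. -/
def characteristicGraph (W : Channel X (Y × Z)) : SimpleGraph (Y ⊕ Z) where
  Adj a b := ∃ y z, ((a = Sum.inl y ∧ b = Sum.inr z) ∨ (a = Sum.inr z ∧ b = Sum.inl y)) ∧
    ∃ x, 0 < W.prob x (y, z)
  symm := ⟨by
    rintro a b ⟨y, z, h, hx⟩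
    exact ⟨y, z, by tauto, hx⟩⟩
  loopless := ⟨by
    rintro a ⟨y, z, ⟨h, h'⟩ | ⟨h, h'⟩, -⟩ <;> simp [h] at h'⟩

/-- The output alphabet of the common channel: the connected components of the
characteristic graph. -/
def CommonAlphabet (W : Channel X (Y × Z)) : Type _ :=
  (characteristicGraph W).ConnectedComponent

instance (W : Channel X (Y × Z)) : Finite (CommonAlphabet W) :=
  inferInstanceAs (Finite (characteristicGraph W).ConnectedComponent)

noncomputable instance (W : Channel X (Y × Z)) : Fintype (CommonAlphabet W) :=
  Fintype.ofFinite _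

/-- `{y, z}` is an edge of the connected component `v` of the characteristic graph. -/
def IsEdgeOf (W : Channel X (Y × Z)) (v : CommonAlphabet W) (y : Y) (z : Z) : Prop :=
  (characteristicGraph W).Adj (Sum.inl y) (Sum.inr z) ∧
    (characteristicGraph W).connectedComponentMk (Sum.inl y) = v

open Classical in
/-- The common channel: the probability of the component `v` given the input `x` is the sum of
`W(y,z|x)` over the edges `{y, z}` of `v`. -/
noncomputable def commonChannel (W : Channel X (Y × Z)) : Channel X (CommonAlphabet W) where
  prob x v := ∑ o : Y × Z, if IsEdgeOf W v o.1 o.2 then W.prob x o else 0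
  nonneg x v := Finset.sum_nonneg fun o _ => by
    split_ifs
    · exact W.nonneg x o
    · exact le_rfl
  sum_eq_one x := by
    rw [Finset.sum_comm, ← W.sum_eq_one x]
    refine Finset.sum_congr rfl fun o _ => ?_
    rcases (W.nonneg x o).eq_or_lt with h | h
    · simp [← h]
    · have hadj : (characteristicGraph W).Adj (Sum.inl o.1) (Sum.inr o.2) :=
        ⟨o.1, o.2, Or.inl ⟨rfl, rfl⟩, x, h⟩
      rw [Finset.sum_eq_single
        (show CommonAlphabet W from (characteristicGraph W).connectedComponentMk (Sum.inl o.1))]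
      · exact if_pos ⟨hadj, rfl⟩
      · intro v _ hv
        exact if_neg fun hE => hv hE.2.symm
      · intro hn
        exact absurd (Finset.mem_univ _) hn

/-- `U` is an effective input alphabet: it contains exactly one letter for each vertex of the
polytope spanned by the output distributions of the common channel. -/
def IsEffectiveAlphabet (W : Channel X (Y × Z)) (U : Set X) : Prop :=
  Set.BijOn (commonChannel W).prob U
    (Set.extremePoints ℝ (convexHull ℝ (Set.range (commonChannel W).prob)))

/-- An effective input alphabet always exists. -/
theorem exists_isEffectiveAlphabet (W : Channel X (Y × Z)) :
    ∃ U, IsEffectiveAlphabet W U := by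
  have h : Set.SurjOn (commonChannel W).prob Set.univ
      (Set.extremePoints ℝ (convexHull ℝ (Set.range (commonChannel W).prob))) := by
    rw [Set.SurjOn, Set.image_univ]
    exact extremePoints_convexHull_subset
  obtain ⟨U, -, hU⟩ := h.exists_bijOn_subset
  exact ⟨U, hU⟩

end Broadcast

end Consensus

namespace Consensus

open Finset

/-! ### Mutual information: attainment of the maximum and the case of capacity zero. -/

section MutualInfo

/-! Lower bound. Two outputs that occur together with positive probability lie in one component of
the characteristic graph, so both receivers compute the same output word of the common channel with
certainty. Applying one point-to-point decoder to that word yields decoders that never disagree,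
whatever is sent; only the honest error remains (`achievable_of_lt_capacity`). It is exponentially
small at every rate below the capacity, by Feinstein's construction together with a Chernoff bound
(`exists_code_of_lt_capacity`).

Converse at capacity zero. The equality case of the divergence inequality makes all rows of the
common channel equal (`prob_eq_of_capacity_eq_zero`). Fix a message and the outputs at all positions
but one; the events that each decoder outputs that message become subsets of the two single-letter
alphabets. If these subsets agree on every edge, they are unions of components, so their probability
does not depend on the input letter. Otherwise some letter produces a disagreement with probability
at least `w`, the least positive transition probability. In both cases, changing a letter moves the
probability by at most `w⁻¹` times the disagreement summed over letters
(`sum_sub_sum_le_of_commonChannel_const`). Changing the letters one by one turns one codeword into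
another at a cost of order `n` times an exponentially small error. Two reliably decoded messages
would need a jump from nearly 0 to nearly 1, so no positive rate is achievable. -/

theorem Channel.sum_joint {A B : Type*} [Fintype B] (W : Channel A B) (P : A → ℝ) (a : A) :
    ∑ b, P a * W.prob a b = P a := by
  rw [← Finset.mul_sum, W.sum_eq_one, mul_one]

variable {A B : Type*} [Fintype A] [Fintype B]

/-- A mutual information as a difference of entropies. -/
theorem mutualInfo_eq_sum_mul_log (W : Channel A B) {P : A → ℝ} (hP : ∀ a, 0 ≤ P a) :
    mutualInfo (fun a b => P a * W.prob a b) =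
      ((∑ a, ∑ b, P a * W.prob a b * Real.log (P a * W.prob a b)) -
        (∑ a, P a * Real.log (P a)) -
        ∑ b, (∑ a, P a * W.prob a b) * Real.log (∑ a, P a * W.prob a b)) / Real.log 2 := by
  have h1 : ∑ a, P a * Real.log (P a) = ∑ a, ∑ b, P a * W.prob a b * Real.log (P a) := by
    refine Finset.sum_congr rfl fun a _ => ?_
    rw [← Finset.sum_mul, W.sum_joint]
  have h2 : ∑ b, (∑ a, P a * W.prob a b) * Real.log (∑ a, P a * W.prob a b) =
      ∑ a, ∑ b, P a * W.prob a b * Real.log (∑ a', P a' * W.prob a' b) := by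
    rw [Finset.sum_comm]
    exact Finset.sum_congr rfl fun b _ => Finset.sum_mul _ _ _
  rw [h1, h2, ← Finset.sum_sub_distrib, ← Finset.sum_sub_distrib, Finset.sum_div]
  refine Finset.sum_congr rfl fun a _ => ?_
  rw [← Finset.sum_sub_distrib, ← Finset.sum_sub_distrib, Finset.sum_div]
  refine Finset.sum_congr rfl fun b _ => ?_
  rw [W.sum_joint]
  have hJ : ∀ a', 0 ≤ P a' * W.prob a' b := fun a' => mul_nonneg (hP a') (W.nonneg a' b)
  rcases (hJ a).eq_or_lt with h | h
  · simp [← h]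
  · have hp : P a ≠ 0 := left_ne_zero_of_mul h.ne'
    have hq : ∑ a', P a' * W.prob a' b ≠ 0 :=
      (h.trans_le (Finset.single_le_sum (fun a' _ => hJ a') (Finset.mem_univ a))).ne'
    rw [Real.logb, Real.log_div h.ne' (mul_ne_zero hp hq), Real.log_mul hp hq]
    ring

/-- The entropy form involves only `t * log t`, which is continuous up to `t = 0`, so the values
form a continuous image of the compact simplex. -/
theorem isCompact_mutualInfoValues (W : Channel A B) : IsCompact (mutualInfoValues W) := by
  refine (isCompact_stdSimplex ℝ A).image_of_continuousOn ?_
  have hc : Continuous fun P : A → ℝ =>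
      ((∑ a, ∑ b, P a * W.prob a b * Real.log (P a * W.prob a b)) -
        (∑ a, P a * Real.log (P a)) -
        ∑ b, (∑ a, P a * W.prob a b) * Real.log (∑ a, P a * W.prob a b)) / Real.log 2 := by
    have hl : ∀ g : (A → ℝ) → ℝ, Continuous g → Continuous fun P => g P * Real.log (g P) :=
      fun g hg => Real.continuous_mul_log.comp hg
    refine ((Continuous.sub (Continuous.sub ?_ ?_) ?_)).div_const _
    · exact continuous_finsetSum _ fun a _ => continuous_finsetSum _ fun b _ =>
        hl (fun P => P a * W.prob a b) (by fun_prop)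
    · exact continuous_finsetSum _ fun a _ => hl (fun P => P a) (by fun_prop)
    · exact continuous_finsetSum _ fun b _ =>
        hl (fun P => ∑ a, P a * W.prob a b) (by fun_prop)
  exact hc.continuousOn.congr fun P hP => mutualInfo_eq_sum_mul_log W hP.1

theorem isGreatest_capacity [Nonempty A] (W : Channel A B) :
    IsGreatest (mutualInfoValues W) (capacity W) := by
  classical
  have hne : (mutualInfoValues W).Nonempty :=
    ⟨_, Pi.single (Classical.arbitrary A) 1, single_mem_stdSimplex ℝ _, rfl⟩
  exact (isCompact_mutualInfoValues W).isGreatest_sSup hne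

/-- This is `log u ≤ u - 1` at `u = t / s`, the termwise form of nonnegativity of divergence.
Absolute continuity is needed because `log (s / 0) = 0` by convention. -/
theorem sub_le_mul_log_div {s t : ℝ} (hs : 0 ≤ s) (ht : 0 ≤ t) (h : t = 0 → s = 0) :
    s - t ≤ s * Real.log (s / t) := by
  rcases hs.eq_or_lt with rfl | hs'
  · simpa using ht
  · have ht' : 0 < t := ht.lt_of_ne fun h0 => hs'.ne' (h h0.symm)
    have := Real.log_le_sub_one_of_pos (div_pos ht' hs')
    rw [← inv_div, Real.log_inv]
    have h3 := mul_le_mul_of_nonneg_left this hs'.le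
    have h4 : s * (t / s - 1) = t - s := by field_simp
    linarith

theorem eq_of_mul_log_div_le {s t : ℝ} (hs : 0 ≤ s) (ht : 0 ≤ t) (h : t = 0 → s = 0)
    (hle : s * Real.log (s / t) ≤ s - t) : s = t := by
  rcases hs.eq_or_lt with rfl | hs'
  · simp at hle
    linarith
  · have ht' : 0 < t := ht.lt_of_ne fun h0 => hs'.ne' (h h0.symm)
    by_contra hne
    have := Real.log_lt_sub_one_of_pos (div_pos ht' hs')
      (fun h1 => hne ((div_eq_one_iff_eq hs'.ne').1 h1).symm)
    rw [← inv_div, Real.log_inv] at hle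
    have h3 := mul_lt_mul_of_pos_left this hs'
    have h4 : s * (t / s - 1) = t - s := by field_simp
    linarith

/-- A channel of capacity zero has the same output distribution for all inputs. -/
theorem prob_eq_of_capacity_eq_zero (W : Channel A B) (h : capacity W = 0) (a a' : A) :
    W.prob a = W.prob a' := by
  classical
  have : Nonempty A := ⟨a⟩
  have hcard : (0 : ℝ) < Fintype.card A := by exact_mod_cast Fintype.card_pos
  -- The uniform input gives every letter positive mass, so equality in the divergence inequality
  -- constrains every row.
  set P : A → ℝ := fun _ => (Fintype.card A : ℝ)⁻¹ with hPdef
  have hPpos : ∀ a, 0 < P a := fun a => inv_pos.2 hcard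
  have hPsum : ∑ a, P a = 1 := by simp [hPdef]
  have hI : mutualInfo (fun a b => P a * W.prob a b) ≤ 0 :=
    h ▸ (isGreatest_capacity W).2 ⟨P, ⟨fun a => (hPpos a).le, hPsum⟩, rfl⟩
  set q : B → ℝ := fun b => ∑ a, P a * W.prob a b with hq
  have hJ : ∀ a b, 0 ≤ P a * W.prob a b := fun a b => mul_nonneg (hPpos a).le (W.nonneg a b)
  have hq0 : ∀ b, 0 ≤ q b := fun b => Finset.sum_nonneg fun a _ => hJ a b
  have hqs : ∑ b, q b = 1 := by
    rw [hq, Finset.sum_comm, ← hPsum]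
    exact Finset.sum_congr rfl fun a _ => W.sum_joint P a
  have habs : ∀ a b, P a * q b = 0 → P a * W.prob a b = 0 := by
    intro a b h0
    rcases mul_eq_zero.1 h0 with h1 | h1
    · rw [h1, zero_mul]
    · exact (Finset.sum_eq_zero_iff_of_nonneg fun a _ => hJ a b).1 h1 a (Finset.mem_univ a)
  have hterm : ∀ a b, P a * W.prob a b - P a * q b ≤
      P a * W.prob a b * Real.log (P a * W.prob a b / (P a * q b)) := fun a b =>
    sub_le_mul_log_div (hJ a b) (mul_nonneg (hPpos a).le (hq0 b)) (habs a b)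
  -- Both families have total mass one, so the termwise lower bounds add up to zero. With zero
  -- mutual information, every term must then be an equality.
  have hsum0 : ∑ a, ∑ b, (P a * W.prob a b - P a * q b) = 0 := by
    simp_rw [Finset.sum_sub_distrib, ← Finset.mul_sum, W.sum_eq_one, hqs]
    simp
  have hle : ∑ a, ∑ b, P a * W.prob a b * Real.log (P a * W.prob a b / (P a * q b)) ≤ 0 := by
    have h2 : mutualInfo (fun a b => P a * W.prob a b) =
        (∑ a, ∑ b, P a * W.prob a b * Real.log (P a * W.prob a b / (P a * q b))) /
          Real.log 2 := by
      simp only [mutualInfo, W.sum_joint, Real.logb, Finset.sum_div, mul_div_assoc, hq]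
    rw [h2] at hI
    by_contra hc
    exact absurd hI (not_le.2 (div_pos (not_le.1 hc) (Real.log_pos one_lt_two)))
  have heq : ∀ a b, W.prob a b = q b := by
    intro a b
    have h3 : ∑ p : A × B, (P p.1 * W.prob p.1 p.2 *
        Real.log (P p.1 * W.prob p.1 p.2 / (P p.1 * q p.2)) -
        (P p.1 * W.prob p.1 p.2 - P p.1 * q p.2)) ≤ 0 := by
      rw [Finset.sum_sub_distrib, Fintype.sum_prod_type, Fintype.sum_prod_type, hsum0]
      simpa using hle
    have h4 := (Finset.single_le_sum (f := fun p : A × B => (P p.1 * W.prob p.1 p.2 *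
        Real.log (P p.1 * W.prob p.1 p.2 / (P p.1 * q p.2)) -
        (P p.1 * W.prob p.1 p.2 - P p.1 * q p.2)))
        (fun p _ => sub_nonneg.2 (hterm p.1 p.2)) (Finset.mem_univ (a, b))).trans h3
    have h5 := eq_of_mul_log_div_le (hJ a b) (mul_nonneg (hPpos a).le (hq0 b)) (habs a b)
      (sub_nonpos.1 h4)
    exact mul_left_cancel₀ (hPpos a).ne' h5
  funext b
  rw [heq, heq]

/-- A point mass as input gives mutual information zero. -/
theorem capacity_nonneg [Nonempty A] (W : Channel A B) : 0 ≤ capacity W := by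
  classical
  refine (isGreatest_capacity W).2
    ⟨Pi.single (Classical.arbitrary A) 1, single_mem_stdSimplex ℝ _, ?_⟩
  have : ∀ a b, (Pi.single (Classical.arbitrary A) (1 : ℝ) : A → ℝ) a * W.prob a b *
      Real.logb 2 ((Pi.single (Classical.arbitrary A) (1 : ℝ) : A → ℝ) a * W.prob a b /
        ((Pi.single (Classical.arbitrary A) (1 : ℝ) : A → ℝ) a *
          W.prob (Classical.arbitrary A) b)) = 0 := by
    intro a b
    by_cases h : a = Classical.arbitrary A
    · subst h
      by_cases h0 : W.prob (Classical.arbitrary A) b = 0 <;> simp [h0]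
    · simp [h]
  simp only [mutualInfo, W.sum_joint]
  refine Finset.sum_eq_zero fun a _ => Finset.sum_eq_zero fun b _ => ?_
  have h1 : ∑ a', (Pi.single (Classical.arbitrary A) (1 : ℝ) : A → ℝ) a' * W.prob a' b =
      W.prob (Classical.arbitrary A) b := by
    simp [Pi.single_apply]
  rw [h1]
  exact this a b

end MutualInfo

/-! ### Point-to-point coding with exponentially small maximal error. -/

section Coding

variable {A B : Type*} [Fintype A] [Fintype B]

open Classical in
/-- Feinstein's maximal code construction. -/
theorem exists_code_of_threshold (W : Channel A B) {P : A → ℝ} (hP : P ∈ stdSimplex ℝ A)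
    {T l : ℝ} (hT : 0 < T) (k : ℕ)
    (hk : k / T + ∑ a, P a * ∑ b, (if W.prob a b ≤ T * ∑ a', P a' * W.prob a' b
      then W.prob a b else 0) ≤ l) :
    ∃ (enc : Fin k → A) (dec : B → Option (Fin k)),
      (∀ m, 1 - l ≤ ∑ b, if dec b = some m then W.prob (enc m) b else 0) ∧
      ∀ b m, dec b = some m → T * ∑ a', P a' * W.prob a' b < W.prob (enc m) b := by
  induction k with
  | zero => exact ⟨Fin.elim0, fun _ => none, fun m => m.elim0, fun b m => m.elim0⟩
  | succ k ih =>
    set q : B → ℝ := fun b => ∑ a', P a' * W.prob a' b with hq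
    set E : ℝ := ∑ a, P a * ∑ b, (if W.prob a b ≤ T * q b then W.prob a b else 0) with hE
    have hk' : k / T + E < l := by
      refine lt_of_lt_of_le ?_ hk
      push_cast
      gcongr
      linarith
    obtain ⟨enc, dec, h1, h2⟩ := ih hk'.le
    -- On each decoding set `T * q < W`, so each set has `q`-mass at most `1 / T`.
    have hused : ∑ b, (if dec b ≠ none then q b else 0) ≤ k / T := by
      have h3 : ∀ b, (if dec b ≠ none then q b else 0) =
          ∑ m, if dec b = some m then q b else 0 := by
        intro b
        cases hd : dec b with
        | none => simp
        | some m => simp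
      simp_rw [h3]
      rw [Finset.sum_comm]
      have h4 : ∀ m, ∑ b, (if dec b = some m then q b else 0) ≤ 1 / T := by
        intro m
        rw [← W.sum_eq_one (enc m), Finset.sum_div]
        refine Finset.sum_le_sum fun b _ => ?_
        split_ifs with hd
        · rw [le_div_iff₀ hT, mul_comm]
          exact (h2 b m hd).le
        · exact div_nonneg (W.nonneg _ _) hT.le
      refine (Finset.sum_le_sum fun m _ => h4 m).trans ?_
      simp [div_eq_mul_inv]
    -- If no letter worked, averaging over `P` would split the total mass into fresh outputs above
    -- the threshold, outputs below it, and outputs already used, giving `1 ≤ (1 - l) + E + k / T <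
    -- 1`.
    obtain ⟨x, hx⟩ : ∃ x, 1 - l ≤ ∑ b,
        if dec b = none ∧ T * q b < W.prob x b then W.prob x b else 0 := by
      by_contra! hcon
      have h5 : ∑ a, P a * ∑ b, (if dec b = none ∧ T * q b < W.prob a b then W.prob a b else 0)
          ≤ 1 - l := by
        refine (Finset.sum_le_sum fun a _ =>
          mul_le_mul_of_nonneg_left (hcon a).le (hP.1 a)).trans ?_
        rw [← Finset.sum_mul, hP.2, one_mul]
      have h6 : ∑ a, P a * ∑ b, (if dec b ≠ none then W.prob a b else 0) ≤ k / T := by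
        refine le_trans (le_of_eq ?_) hused
        simp_rw [Finset.mul_sum]
        rw [Finset.sum_comm]
        refine Finset.sum_congr rfl fun b _ => ?_
        split_ifs <;> simp [hq]
      have h7 : ∑ a, P a * (1 : ℝ) ≤
          ∑ a, (P a * ∑ b, (if dec b = none ∧ T * q b < W.prob a b then W.prob a b else 0) +
            P a * ∑ b, (if W.prob a b ≤ T * q b then W.prob a b else 0) +
            P a * ∑ b, (if dec b ≠ none then W.prob a b else 0)) := by
        refine Finset.sum_le_sum fun a _ => ?_
        rw [← mul_add, ← mul_add]
        refine mul_le_mul_of_nonneg_left ?_ (hP.1 a)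
        rw [← W.sum_eq_one a, ← Finset.sum_add_distrib, ← Finset.sum_add_distrib]
        refine Finset.sum_le_sum fun b _ => ?_
        have := W.nonneg a b
        by_cases hd : dec b = none
        · rcases le_or_gt (W.prob a b) (T * q b) with hc | hc
          · simp [hd, hc, hc.not_gt]
          · simp [hd, hc, hc.not_ge]
        · simp only [hd, false_and, if_false, ne_eq, not_false_eq_true, if_true]
          split_ifs <;> linarith
      rw [Finset.sum_add_distrib, Finset.sum_add_distrib] at h7
      simp only [mul_one, hP.2] at h7
      linarith
    -- The new message receives the outputs above its threshold that no earlier message uses; old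
    -- decoding sets are unchanged.
    refine ⟨Fin.snoc (α := fun _ => A) enc x, fun b => (dec b).elim
      (if T * q b < W.prob x b then some (Fin.last k) else none) fun m => some m.castSucc, ?_, ?_⟩
    · intro m
      refine Fin.lastCases ?_ (fun m => ?_) m
      · rw [Fin.snoc_last]
        refine hx.trans (le_of_eq (Finset.sum_congr rfl fun b _ => ?_))
        cases hd : dec b with
        | none => simp [hd]
        | some j => simp [hd, (Fin.castSucc_lt_last j).ne]
      · rw [Fin.snoc_castSucc]
        refine (h1 m).trans (le_of_eq (Finset.sum_congr rfl fun b _ => ?_))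
        cases hd : dec b with
        | none => simp [hd, (Fin.castSucc_lt_last m).ne']
        | some j => simp [hd]
    · intro b m
      cases hd : dec b with
      | none =>
        simp only [hd, Option.elim_none, Option.ite_none_right_eq_some, Option.some.injEq, and_imp]
        rintro h3 rfl
        rw [Fin.snoc_last]
        exact h3
      | some j =>
        simp only [hd, Option.elim_some, Option.some.injEq]
        rintro rfl
        rw [Fin.snoc_castSucc]
        exact h2 b j hd

/-- The memoryless extension of a channel to words of length `n`. -/
def Channel.pow (W : Channel A B) (n : ℕ) : Channel (Fin n → A) (Fin n → B) where
  prob x y := ∏ i, W.prob (x i) (y i)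
  nonneg x y := Finset.prod_nonneg fun i _ => W.nonneg _ _
  sum_eq_one x := by
    rw [← Fintype.prod_sum fun i b => W.prob (x i) b]
    simp [W.sum_eq_one]

theorem prod_mem_stdSimplex {P : A → ℝ} (hP : P ∈ stdSimplex ℝ A) (n : ℕ) :
    (fun x : Fin n → A => ∏ i, P (x i)) ∈ stdSimplex ℝ (Fin n → A) := by
  refine ⟨fun x => Finset.prod_nonneg fun i _ => hP.1 _, ?_⟩
  rw [← Fintype.prod_sum fun (_ : Fin n) a => P a]
  simp [hP.2]

theorem sum_prod_mul_pow_prob (W : Channel A B) (P : A → ℝ) {n : ℕ} (y : Fin n → B) :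
    ∑ x : Fin n → A, (∏ i, P (x i)) * (W.pow n).prob x y =
      ∏ i, ∑ a, P a * W.prob a (y i) := by
  simp only [Channel.pow, ← Finset.prod_mul_distrib]
  rw [Fintype.prod_sum]

/-- The moment generating function of minus the information density. -/
noncomputable def infoMgf (W : Channel A B) (P : A → ℝ) (s : ℝ) : ℝ :=
  ∑ a, ∑ b, P a * W.prob a b *
    Real.exp (-(s * Real.log (W.prob a b / ∑ a', P a' * W.prob a' b)))

/-- Chernoff's bound for the information density of a memoryless channel. -/
theorem sum_prob_le_threshold (W : Channel A B) {P : A → ℝ} (hP : P ∈ stdSimplex ℝ A)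
    {R s : ℝ} (hs : 0 ≤ s) (n : ℕ) [∀ x y, Decidable ((W.pow n).prob x y ≤ Real.exp (n * R) *
      ∑ x' : Fin n → A, (∏ i, P (x' i)) * (W.pow n).prob x' y)] :
    ∑ x : Fin n → A, (∏ i, P (x i)) * ∑ y, (if (W.pow n).prob x y ≤ Real.exp (n * R) *
      ∑ x' : Fin n → A, (∏ i, P (x' i)) * (W.pow n).prob x' y then (W.pow n).prob x y else 0) ≤
    (Real.exp (s * R) * infoMgf W P s) ^ n := by
  set q : B → ℝ := fun b => ∑ a', P a' * W.prob a' b with hq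
  have hexp : (Real.exp (s * R) * infoMgf W P s) ^ n = ∑ x : Fin n → A, ∑ y : Fin n → B,
      ∏ i, (Real.exp (s * R) * (P (x i) * W.prob (x i) (y i) *
        Real.exp (-(s * Real.log (W.prob (x i) (y i) / q (y i)))))) := by
    have h1 : Real.exp (s * R) * infoMgf W P s = ∑ a, ∑ b, Real.exp (s * R) *
        (P a * W.prob a b * Real.exp (-(s * Real.log (W.prob a b / q b)))) := by
      simp_rw [infoMgf, Finset.mul_sum, hq]
    have h2 : (Real.exp (s * R) * infoMgf W P s) ^ n = ∏ _i : Fin n, ∑ a, ∑ b, Real.exp (s * R) *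
        (P a * W.prob a b * Real.exp (-(s * Real.log (W.prob a b / q b)))) := by
      rw [h1]; simp
    rw [h2, Fintype.prod_sum]
    refine Finset.sum_congr rfl fun x _ => ?_
    rw [Fintype.prod_sum]
  rw [hexp]
  refine Finset.sum_le_sum fun x _ => ?_
  rw [Finset.mul_sum]
  refine Finset.sum_le_sum fun y _ => ?_
  have hnn : 0 ≤ ∏ i, (Real.exp (s * R) * (P (x i) * W.prob (x i) (y i) *
        Real.exp (-(s * Real.log (W.prob (x i) (y i) / q (y i)))))) :=
    Finset.prod_nonneg fun i _ => mul_nonneg (Real.exp_pos _).le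
      (mul_nonneg (mul_nonneg (hP.1 _) (W.nonneg _ _)) (Real.exp_pos _).le)
  split_ifs with hle
  swap
  · rwa [mul_zero]
  -- Zero factors are separated because the logarithms take default values there; such terms
  -- contribute nothing on the left.
  by_cases h0 : ∃ i, P (x i) * W.prob (x i) (y i) = 0
  · obtain ⟨i, hi⟩ := h0
    refine le_trans (le_of_eq ?_) hnn
    rw [Channel.pow, ← Finset.prod_mul_distrib]
    exact Finset.prod_eq_zero (Finset.mem_univ i) hi
  push Not at h0
  rw [sum_prod_mul_pow_prob] at hle
  have hWpos : ∀ i, 0 < W.prob (x i) (y i) := fun i =>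
    (W.nonneg _ _).lt_of_ne (right_ne_zero_of_mul (h0 i)).symm
  have hqpos : ∀ i, 0 < q (y i) := fun i => by
    have hJ : ∀ a, 0 ≤ P a * W.prob a (y i) := fun a => mul_nonneg (hP.1 a) (W.nonneg _ _)
    exact ((hJ (x i)).lt_of_ne (h0 i).symm).trans_le
      (Finset.single_le_sum (f := fun a => P a * W.prob a (y i)) (fun a _ => hJ a)
        (Finset.mem_univ (x i)))
  -- The threshold event says that the information density is at most `n * R`, so the exponential
  -- weight extracted below is at least one.
  have hlog : ∑ i, Real.log (W.prob (x i) (y i) / q (y i)) ≤ n * R := by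
    have h3 : (W.pow n).prob x y = Real.exp (∑ i, Real.log (W.prob (x i) (y i) / q (y i))) *
        ∏ i, q (y i) := by
      change ∏ i, W.prob (x i) (y i) = _
      rw [Real.exp_sum, ← Finset.prod_mul_distrib]
      refine Finset.prod_congr rfl fun i _ => ?_
      rw [Real.exp_log (div_pos (hWpos i) (hqpos i)), div_mul_cancel₀ _ (hqpos i).ne']
    rw [h3] at hle
    exact Real.exp_le_exp.1 (le_of_mul_le_mul_right hle (Finset.prod_pos (s := univ) fun i _ => hqpos i))
  have h4 : ∏ i, (Real.exp (s * R) * (P (x i) * W.prob (x i) (y i) *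
        Real.exp (-(s * Real.log (W.prob (x i) (y i) / q (y i)))))) =
      Real.exp (s * (n * R - ∑ i, Real.log (W.prob (x i) (y i) / q (y i)))) *
        ((∏ i, P (x i)) * (W.pow n).prob x y) := by
    have h5 : s * (n * R - ∑ i, Real.log (W.prob (x i) (y i) / q (y i))) =
        ∑ i, (s * R + -(s * Real.log (W.prob (x i) (y i) / q (y i)))) := by
      rw [Finset.sum_add_distrib, Finset.sum_const, Finset.card_univ, Fintype.card_fin,
        nsmul_eq_mul, Finset.sum_neg_distrib, ← Finset.mul_sum]
      ring
    rw [h5, Real.exp_sum, Channel.pow, ← Finset.prod_mul_distrib, ← Finset.prod_mul_distrib]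
    refine Finset.prod_congr rfl fun i _ => ?_
    rw [Real.exp_add]
    ring
  rw [h4]
  refine le_mul_of_one_le_left ?_ (Real.one_le_exp (mul_nonneg hs (sub_nonneg.2 hlog)))
  exact mul_nonneg (Finset.prod_nonneg fun i _ => hP.1 _) ((W.pow n).nonneg _ _)

/-- The function equals `1` at `s = 0` and has derivative `R` minus the mutual information in nats
there, which is negative; a small positive `s` works. -/
theorem exists_exp_mul_infoMgf_lt_one (W : Channel A B) {P : A → ℝ} (hP : P ∈ stdSimplex ℝ A)
    {R : ℝ} (hR : R < mutualInfo (fun a b => P a * W.prob a b) * Real.log 2) :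
    ∃ s, 0 < s ∧ Real.exp (s * R) * infoMgf W P s < 1 := by
  set L : A → B → ℝ := fun a b => Real.log (W.prob a b / ∑ a', P a' * W.prob a' b) with hL
  have hI : mutualInfo (fun a b => P a * W.prob a b) * Real.log 2 =
      ∑ a, ∑ b, P a * W.prob a b * L a b := by
    simp only [mutualInfo, W.sum_joint, Finset.sum_mul]
    refine Finset.sum_congr rfl fun a _ => Finset.sum_congr rfl fun b _ => ?_
    by_cases h0 : P a = 0
    · simp [h0]
    · rw [mul_div_mul_left _ _ h0, Real.logb, mul_assoc,
        div_mul_cancel₀ _ (Real.log_pos one_lt_two).ne']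
  have hderiv : HasDerivAt (fun s => Real.exp (s * R) * infoMgf W P s)
      (R - ∑ a, ∑ b, P a * W.prob a b * L a b) 0 := by
    have h1 : HasDerivAt (infoMgf W P) (∑ a, ∑ b, P a * W.prob a b * (-L a b)) 0 := by
      unfold infoMgf
      refine HasDerivAt.fun_sum fun a _ => HasDerivAt.fun_sum fun b _ => ?_
      have h2 : HasDerivAt (fun s : ℝ => Real.exp (-(s * L a b))) (-L a b) 0 := by
        have := (((hasDerivAt_id (0 : ℝ)).mul_const (L a b)).neg).exp
        simpa using this
      exact h2.const_mul _
    have h3 : HasDerivAt (fun s : ℝ => Real.exp (s * R)) R 0 := by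
      have := ((hasDerivAt_id (0 : ℝ)).mul_const R).exp
      simpa using this
    have h4 : infoMgf W P 0 = 1 := by
      simp [infoMgf, W.sum_joint, hP.2]
    have := h3.mul h1
    rw [h4] at this
    refine this.congr_deriv ?_
    simp [Finset.sum_neg_distrib]
    ring
  have h0 : Real.exp (0 * R) * infoMgf W P 0 = 1 := by
    simp [infoMgf, W.sum_joint, hP.2]
  have hneg : R - ∑ a, ∑ b, P a * W.prob a b * L a b < 0 := by linarith [hI ▸ hR]
  have hslope := (hasDerivAt_iff_tendsto_slope.1 hderiv).eventually_lt_const hneg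
  have hev : ∀ᶠ s in nhdsWithin (0 : ℝ) (Set.Ioi 0),
      slope (fun s => Real.exp (s * R) * infoMgf W P s) 0 s < 0 :=
    hslope.filter_mono (nhdsWithin_mono _ fun s hs => ne_of_gt (Set.mem_Ioi.1 hs))
  obtain ⟨s, hs, hs0⟩ := (hev.and self_mem_nhdsWithin).exists
  refine ⟨s, hs0, ?_⟩
  rw [slope_def_field, h0, sub_zero] at hs
  have := (div_neg_iff.1 hs).resolve_left fun h => absurd h.2 (not_lt.2 (le_of_lt hs0))
  linarith [this.1]

open Classical in
/-- The direct part of the channel coding theorem, with exponentially small maximal error. -/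
theorem exists_code_of_lt_capacity [Nonempty A] (W : Channel A B) {R : ℝ}
    (hR : R < capacity W) :
    ∃ ε : ℝ, 0 < ε ∧ ∀ᶠ n : ℕ in Filter.atTop,
      ∃ (enc : Fin ⌊(2 : ℝ) ^ ((n : ℝ) * R)⌋₊ → Fin n → A)
        (dec : (Fin n → B) → Option (Fin ⌊(2 : ℝ) ^ ((n : ℝ) * R)⌋₊)),
        ∀ m, 1 - (2 : ℝ) ^ (-((n : ℝ) * ε)) ≤
          ∑ y, if dec y = some m then (W.pow n).prob (enc m) y else 0 := by
  obtain ⟨P, hP, hPI⟩ := (isGreatest_capacity W).1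
  obtain ⟨R', hR1, hR2⟩ := exists_between hR
  have hlog2 : 0 < Real.log 2 := Real.log_pos one_lt_two
  obtain ⟨s, hs, hs1⟩ := exists_exp_mul_infoMgf_lt_one W hP (R := R' * Real.log 2)
    (mul_lt_mul_of_pos_right (hR2.trans_eq hPI.symm) hlog2)
  set r := Real.exp (s * (R' * Real.log 2)) * infoMgf W P s with hr
  have hr0 : 0 ≤ r := mul_nonneg (Real.exp_pos _).le <| Finset.sum_nonneg fun a _ =>
    Finset.sum_nonneg fun b _ => mul_nonneg (mul_nonneg (hP.1 a) (W.nonneg a b)) (Real.exp_pos _).le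
  set t := Real.exp ((R - R') * Real.log 2) with ht
  have ht0 : 0 < t := Real.exp_pos _
  have ht1 : t < 1 := Real.exp_lt_one_iff.2 (mul_neg_of_neg_of_pos (sub_neg.2 hR1) hlog2)
  -- `r ^ n` bounds the Chernoff term and `t ^ n` the number of messages divided by the threshold.
  -- Since `c` exceeds both bases, each is eventually below `c ^ n / 2`.
  obtain ⟨c, hc, hc1⟩ := exists_between (max_lt hs1 ht1)
  have hc0 : 0 < c := ht0.trans ((le_max_right _ _).trans_lt hc)
  have hcr : r / c < 1 := (div_lt_one hc0).2 ((le_max_left _ _).trans_lt hc)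
  have hct : t / c < 1 := (div_lt_one hc0).2 ((le_max_right _ _).trans_lt hc)
  have hcpow : ∀ n : ℕ, (2 : ℝ) ^ (-((n : ℝ) * (-Real.logb 2 c))) = c ^ n := by
    intro n
    rw [mul_neg, neg_neg, mul_comm, Real.rpow_mul two_pos.le,
      Real.rpow_logb two_pos (by norm_num) hc0, Real.rpow_natCast]
  refine ⟨-Real.logb 2 c, neg_pos.2 (Real.logb_neg one_lt_two hc0 hc1), ?_⟩
  have e1 := (tendsto_pow_atTop_nhds_zero_of_lt_one (div_nonneg hr0 hc0.le) hcr).eventually_lt_const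
    (u := 1 / 2) (by norm_num)
  have e2 := (tendsto_pow_atTop_nhds_zero_of_lt_one (div_nonneg ht0.le hc0.le) hct).eventually_lt_const
    (u := 1 / 2) (by norm_num)
  filter_upwards [e1, e2] with n hn1 hn2
  have hcn : 0 < c ^ n := pow_pos hc0 n
  rw [div_pow, div_lt_iff₀ hcn] at hn1 hn2
  obtain ⟨enc, dec, h, -⟩ := exists_code_of_threshold (W.pow n) (prod_mem_stdSimplex hP n)
    (T := Real.exp (n * (R' * Real.log 2))) (l := c ^ n) (Real.exp_pos _)
    ⌊(2 : ℝ) ^ ((n : ℝ) * R)⌋₊ (by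
      have h1 := sum_prob_le_threshold W hP (R := R' * Real.log 2) hs.le n
      have h2 : (⌊(2 : ℝ) ^ ((n : ℝ) * R)⌋₊ : ℝ) / Real.exp (n * (R' * Real.log 2)) ≤ t ^ n := by
        rw [div_le_iff₀ (Real.exp_pos _), ht, ← Real.exp_nat_mul, ← Real.exp_add]
        refine (Nat.floor_le (Real.rpow_nonneg two_pos.le _)).trans (le_of_eq ?_)
        rw [Real.rpow_def_of_pos two_pos]
        congr 1
        ring
      refine (add_le_add h2 h1).trans ?_
      linarith)
  refine ⟨enc, dec, fun m => ?_⟩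
  rw [hcpow]
  exact h m

end Coding

/-! ### Elementary facts on consensus codes and boundedness of the achievable rates. -/

section Broadcast

variable {X Y Z : Type*} [Fintype Y] [Fintype Z]

open Classical in
theorem prOut_eq_sum_pow (W : Channel X (Y × Z)) {n : ℕ} (x : Fin n → X)
    (E : Set ((Fin n → Y) × (Fin n → Z))) :
    prOut W x E = ∑ o : Fin n → Y × Z,
      if (fun i => (o i).1, fun i => (o i).2) ∈ E then (W.pow n).prob x o else 0 := by
  symm
  exact Fintype.sum_equiv (Equiv.arrowProdEquivProdArrow (Fin n) (fun _ => Y) fun _ => Z) _ _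
    fun o => rfl

theorem prOut_mono (W : Channel X (Y × Z)) {n : ℕ} (x : Fin n → X)
    {E F : Set ((Fin n → Y) × (Fin n → Z))} (h : E ⊆ F) : prOut W x E ≤ prOut W x F := by
  classical
  refine Finset.sum_le_sum fun o _ => ?_
  have h0 : 0 ≤ ∏ i, W.prob (x i) (o.1 i, o.2 i) := Finset.prod_nonneg fun i _ => W.nonneg _ _
  by_cases hE : o ∈ E
  · rw [if_pos hE, if_pos (h hE)]
  · rw [if_neg hE]
    split_ifs <;> linarith

theorem prOut_univ (W : Channel X (Y × Z)) {n : ℕ} (x : Fin n → X) :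
    prOut W x Set.univ = 1 := by
  classical
  rw [prOut_eq_sum_pow, ← (W.pow n).sum_eq_one x]
  simp

theorem prOut_add_le_one (W : Channel X (Y × Z)) {n : ℕ} (x : Fin n → X)
    {E F : Set ((Fin n → Y) × (Fin n → Z))} (h : Disjoint E F) :
    prOut W x E + prOut W x F ≤ 1 := by
  classical
  rw [← prOut_univ W x, prOut, prOut, prOut, ← Finset.sum_add_distrib]
  refine Finset.sum_le_sum fun o _ => ?_
  have h0 : 0 ≤ ∏ i, W.prob (x i) (o.1 i, o.2 i) := Finset.prod_nonneg fun i _ => W.nonneg _ _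
  rw [if_pos (Set.mem_univ o)]
  by_cases hE : o ∈ E
  · rw [if_pos hE, if_neg (Set.disjoint_left.1 h hE), add_zero]
  · rw [if_neg hE, zero_add]
    split_ifs <;> linarith

theorem honestError_le_errorProb (W : Channel X (Y × Z)) {n K : ℕ} (c : Code X Y Z n K)
    (m : Fin K) : honestError W c m ≤ errorProb W c :=
  (le_ciSup (Set.finite_range _).bddAbove m).trans (le_max_left _ _)

theorem disagreement_le_errorProb [Finite X] (W : Channel X (Y × Z)) {n K : ℕ}
    (c : Code X Y Z n K) (x : Fin n → X) : disagreement W c x ≤ errorProb W c :=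
  (le_ciSup (Set.finite_range _).bddAbove x).trans (le_max_right _ _)

/-- Nonnegativity of `δ` covers an empty index type, over which the real supremum is `0` by
convention. -/
theorem errorProb_le (W : Channel X (Y × Z)) {n K : ℕ} {c : Code X Y Z n K} {δ : ℝ}
    (hδ : 0 ≤ δ) (h : ∀ m, honestError W c m ≤ δ) (h' : ∀ x, disagreement W c x ≤ δ) :
    errorProb W c ≤ δ :=
  max_le (Real.iSup_le h hδ) (Real.iSup_le h' hδ)

theorem achievable_zero [Nonempty X] (W : Channel X (Y × Z)) : Achievable W 0 := by
  refine ⟨le_rfl, 1, one_pos, Filter.Eventually.of_forall fun n => ?_⟩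
  have hK : ⌊(2 : ℝ) ^ ((n : ℝ) * 0)⌋₊ = 1 := by simp
  rw [hK]
  refine ⟨⟨fun _ _ => Classical.arbitrary X, fun _ => some 0, fun _ => some 0⟩, ?_⟩
  refine errorProb_le W (Real.rpow_nonneg two_pos.le _) (fun m => ?_) (fun x => ?_)
  · have hm : m = 0 := Subsingleton.elim _ _
    subst hm
    refine le_trans (le_of_eq ?_) (Real.rpow_nonneg two_pos.le _)
    simp only [honestError, and_self, Set.ofPred_true, prOut_univ, sub_self]
  · refine le_trans (le_of_eq ?_) (Real.rpow_nonneg two_pos.le _)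
    simp [disagreement, prOut]

/-- Distinct messages of a code of error less than `1 / 2` have distinct codewords. -/
theorem enc_injective_of_errorProb_lt (W : Channel X (Y × Z)) {n K : ℕ} (c : Code X Y Z n K)
    (h : errorProb W c < 1 / 2) : Function.Injective c.enc := by
  intro m m' hmm
  by_contra hne
  have h1 := honestError_le_errorProb W c m
  have h2 := honestError_le_errorProb W c m'
  rw [honestError] at h1 h2
  rw [← hmm] at h2
  have h3 := prOut_add_le_one W (c.enc m)
    (E := {o | c.decB o.1 = some m ∧ c.decC o.2 = some m})
    (F := {o | c.decB o.1 = some m' ∧ c.decC o.2 = some m'})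
    (Set.disjoint_left.2 fun o ho ho' => hne (Option.some.inj (ho.1.symm.trans ho'.1)))
  linarith

theorem tendsto_two_rpow_neg_mul {ε : ℝ} (hε : 0 < ε) :
    Filter.Tendsto (fun n : ℕ => (n : ℝ) * (2 : ℝ) ^ (-((n : ℝ) * ε))) Filter.atTop (nhds 0) ∧
    Filter.Tendsto (fun n : ℕ => (2 : ℝ) ^ (-((n : ℝ) * ε))) Filter.atTop (nhds 0) := by
  have h : ∀ n : ℕ, (2 : ℝ) ^ (-((n : ℝ) * ε)) = ((2 : ℝ) ^ (-ε)) ^ n := fun n => by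
    rw [← Real.rpow_natCast, ← Real.rpow_mul two_pos.le]
    congr 1
    ring
  have h0 : (0 : ℝ) ≤ (2 : ℝ) ^ (-ε) := Real.rpow_nonneg two_pos.le _
  have h1 : (2 : ℝ) ^ (-ε) < 1 := Real.rpow_lt_one_of_one_lt_of_neg one_lt_two (neg_lt_zero.2 hε)
  simp_rw [h]
  exact ⟨tendsto_self_mul_const_pow_of_lt_one h0 h1, tendsto_pow_atTop_nhds_zero_of_lt_one h0 h1⟩

/-- Once the error is below `1 / 2`, codewords are distinct, so there are at most `|X| ^ n`
messages. -/
theorem bddAbove_achievable [Fintype X] [Nonempty X] (W : Channel X (Y × Z)) :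
    BddAbove {R | Achievable W R} := by
  refine ⟨Real.logb 2 (2 * Fintype.card X), ?_⟩
  rintro R ⟨-, ε, hε, hev⟩
  obtain ⟨n, ⟨c, hc⟩, hδ, hn⟩ := (hev.and (((tendsto_two_rpow_neg_mul hε).2.eventually_lt_const
    (u := 1 / 2) (by norm_num)).and (Filter.eventually_ge_atTop 1))).exists
  have hinj := enc_injective_of_errorProb_lt W c (hc.trans_lt hδ)
  have hcard : ⌊(2 : ℝ) ^ ((n : ℝ) * R)⌋₊ ≤ Fintype.card X ^ n := by
    simpa using Fintype.card_le_of_injective _ hinj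
  have hX : (1 : ℝ) ≤ Fintype.card X := by exact_mod_cast Fintype.card_pos (α := X)
  -- The extra factor `2 ^ n ≥ 2` absorbs the loss of the floor: `|X| ^ n + 1 ≤ 2 * |X| ^ n`.
  have hpow : (2 : ℝ) ^ ((n : ℝ) * R) ≤ (2 * Fintype.card X : ℝ) ^ n := by
    have h1 := (Nat.lt_floor_add_one ((2 : ℝ) ^ ((n : ℝ) * R))).le
    have h2 : (⌊(2 : ℝ) ^ ((n : ℝ) * R)⌋₊ : ℝ) ≤ (Fintype.card X : ℝ) ^ n := by
      exact_mod_cast hcard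
    have h3 : (1 : ℝ) ≤ (Fintype.card X : ℝ) ^ n := one_le_pow₀ hX
    have h4 : (2 : ℝ) ≤ 2 ^ n := le_self_pow₀ one_le_two (by lia)
    rw [mul_pow]
    nlinarith
  have h5 := Real.logb_le_logb_of_le one_lt_two (Real.rpow_pos_of_pos two_pos _) hpow
  rw [Real.logb_rpow two_pos (by norm_num), Real.logb_pow] at h5
  exact le_of_mul_le_mul_left h5 (by exact_mod_cast hn)

theorem isLUB_consensusCapacity [Fintype X] [Nonempty X] (W : Channel X (Y × Z)) :
    IsLUB {R | Achievable W R} (consensusCapacity W) :=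
  isLUB_csSup ⟨0, achievable_zero W⟩ (bddAbove_achievable W)

/-! ### Common components of the two outputs -/

/-- The component of the characteristic graph that contains the output `y` of the first
receiver. -/
def componentB (W : Channel X (Y × Z)) (y : Y) : CommonAlphabet W :=
  (characteristicGraph W).connectedComponentMk (Sum.inl y)

/-- The component of the characteristic graph that contains the output `z` of the second
receiver. -/
def componentC (W : Channel X (Y × Z)) (z : Z) : CommonAlphabet W :=
  (characteristicGraph W).connectedComponentMk (Sum.inr z)

theorem adj_of_prob_pos (W : Channel X (Y × Z)) {x : X} {o : Y × Z} (h : 0 < W.prob x o) :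
    (characteristicGraph W).Adj (Sum.inl o.1) (Sum.inr o.2) :=
  ⟨o.1, o.2, Or.inl ⟨rfl, rfl⟩, x, h⟩

theorem componentB_eq_componentC (W : Channel X (Y × Z)) {x : X} {o : Y × Z}
    (h : 0 < W.prob x o) : componentB W o.1 = componentC W o.2 :=
  SimpleGraph.ConnectedComponent.sound (adj_of_prob_pos W h).reachable

open Classical in
theorem commonChannel_prob_eq (W : Channel X (Y × Z)) (x : X) (v : CommonAlphabet W) :
    (commonChannel W).prob x v = ∑ o, if componentB W o.1 = v then W.prob x o else 0 := by
  refine Finset.sum_congr rfl fun o _ => ?_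
  rcases (W.nonneg x o).eq_or_lt with h | h
  · simp [← h]
  · exact if_congr (and_iff_right (adj_of_prob_pos W h)) rfl rfl

open Classical in
theorem commonChannel_pow_prob_eq (W : Channel X (Y × Z)) {n : ℕ} (x : Fin n → X)
    (v : Fin n → CommonAlphabet W) :
    ((commonChannel W).pow n).prob x v = ∑ o : Fin n → Y × Z,
      if (fun i => componentB W (o i).1) = v then (W.pow n).prob x o else 0 := by
  simp only [Channel.pow, commonChannel_prob_eq]
  rw [Fintype.prod_sum]
  refine Finset.sum_congr rfl fun o _ => ?_
  rw [Finset.prod_ite_zero]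
  simp [funext_iff]

theorem componentB_word_eq (W : Channel X (Y × Z)) {n : ℕ} {x : Fin n → X} {o : Fin n → Y × Z}
    (h : (W.pow n).prob x o ≠ 0) :
    (fun i => componentB W (o i).1) = fun i => componentC W (o i).2 := by
  funext i
  change ∏ i, W.prob (x i) (o i) ≠ 0 at h
  have hi : W.prob (x i) (o i) ≠ 0 := Finset.prod_ne_zero_iff.1 h i (Finset.mem_univ i)
  exact componentB_eq_componentC W ((W.nonneg _ _).lt_of_ne hi.symm)

/-- A code for the common channel is a consensus code without disagreement. -/
theorem achievable_of_lt_capacity [Fintype X] [Nonempty X] (W : Channel X (Y × Z)) {R : ℝ}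
    (h0 : 0 ≤ R) (hR : R < capacity (commonChannel W)) : Achievable W R := by
  classical
  obtain ⟨ε, hε, hev⟩ := exists_code_of_lt_capacity (commonChannel W) hR
  refine ⟨h0, ε, hε, hev.mono ?_⟩
  rintro n ⟨enc, dec, h⟩
  refine ⟨⟨enc, fun y => dec fun i => componentB W (y i),
    fun z => dec fun i => componentC W (z i)⟩, ?_⟩
  refine errorProb_le W (Real.rpow_nonneg two_pos.le _) (fun m => ?_) (fun x => ?_)
  · rw [honestError, sub_le_comm]
    refine (h m).trans (le_of_eq ?_)
    rw [prOut_eq_sum_pow]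
    have h1 : ∀ v : Fin n → CommonAlphabet W,
        (if dec v = some m then ((commonChannel W).pow n).prob (enc m) v else 0) =
        ∑ o : Fin n → Y × Z, if (fun i => componentB W (o i).1) = v then
          (if dec v = some m then (W.pow n).prob (enc m) o else 0) else 0 := by
      intro v
      rw [commonChannel_pow_prob_eq]
      split_ifs <;> simp
    simp_rw [h1]
    rw [Finset.sum_comm]
    refine Finset.sum_congr rfl fun o _ => ?_
    rw [Finset.sum_ite_eq, if_pos (Finset.mem_univ _)]
    by_cases hp : (W.pow n).prob (enc m) o = 0
    · simp [hp]
    · have h2 := componentB_word_eq W hp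
      simp only [Set.mem_ofPred_eq]
      simp only [h2, and_self]
  · refine le_trans (le_of_eq ?_) (Real.rpow_nonneg two_pos.le _)
    rw [disagreement, prOut_eq_sum_pow]
    refine Finset.sum_eq_zero fun o _ => ?_
    by_cases hp : (W.pow n).prob x o = 0
    · simp [hp]
    · have h2 := componentB_word_eq W hp
      exact if_neg fun hne => hne (congrArg dec h2)

/-! ### The converse for a common channel of capacity zero -/

theorem exists_pos_le_prob [Fintype X] (W : Channel X (Y × Z)) :
    ∃ w : ℝ, 0 < w ∧ ∀ x o, 0 < W.prob x o → w ≤ W.prob x o := by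
  classical
  rcases (Finset.univ.filter fun p : X × (Y × Z) => 0 < W.prob p.1 p.2).eq_empty_or_nonempty
    with h | h
  · refine ⟨1, one_pos, fun x o hx => ?_⟩
    exact absurd hx (Finset.filter_eq_empty_iff.1 h (Finset.mem_univ (x, o)))
  · obtain ⟨p, hp, hmin⟩ := Finset.exists_min_image _ (fun p => W.prob p.1 p.2) h
    exact ⟨_, (Finset.mem_filter.1 hp).2, fun x o hx =>
      hmin (x, o) (Finset.mem_filter.2 ⟨Finset.mem_univ _, hx⟩)⟩

open Classical in
/-- If the common channel is constant, the law of a binary function of `Y` depends on the input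
only through the probability that it differs from a given binary function of `Z`. -/
theorem sum_sub_sum_le_of_commonChannel_const [Fintype X] (W : Channel X (Y × Z))
    (hW : ∀ a b, (commonChannel W).prob a = (commonChannel W).prob b)
    {w : ℝ} (hw : 0 < w) (hmin : ∀ x o, 0 < W.prob x o → w ≤ W.prob x o)
    (f : Y → Prop) (g : Z → Prop) (a b : X) :
    (∑ o, if f o.1 then W.prob a o else 0) - (∑ o, if f o.1 then W.prob b o else 0) ≤
      w⁻¹ * ∑ x, ∑ o, if f o.1 ↔ g o.2 then 0 else W.prob x o := by
  have hnn : ∀ x o, 0 ≤ if f o.1 ↔ g o.2 then 0 else W.prob x o := fun x o => by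
    have := W.nonneg x o
    split_ifs <;> linarith
  by_cases hall : ∀ x o, 0 < W.prob x o → (f o.1 ↔ g o.2)
  · have hreach : ∀ s t, (characteristicGraph W).Reachable s t →
        (Sum.elim f g s ↔ Sum.elim f g t) := by
      rintro s t ⟨p⟩
      induction p with
      | nil => exact Iff.rfl
      | cons hadj _ ih =>
        refine Iff.trans ?_ ih
        obtain ⟨y, z, ⟨rfl, rfl⟩ | ⟨rfl, rfl⟩, x, hx⟩ := hadj
        · exact hall x (y, z) hx
        · exact (hall x (y, z) hx).symm
    -- As `f` and `g` agree along every edge, `f` is constant on components, so its probability is a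
    -- sum over common outputs.
    have hf : ∀ y, f y ↔ ∃ y', componentB W y' = componentB W y ∧ f y' := fun y =>
      ⟨fun hy => ⟨y, rfl, hy⟩, fun ⟨y', h1, h2⟩ =>
        (hreach _ _ (SimpleGraph.ConnectedComponent.exact h1)).1 h2⟩
    have hsum : ∀ x, (∑ o, if f o.1 then W.prob x o else 0) =
        ∑ v, if ∃ y', componentB W y' = v ∧ f y' then (commonChannel W).prob x v else 0 := by
      intro x
      have h1 : ∀ v, (if ∃ y', componentB W y' = v ∧ f y' then (commonChannel W).prob x v else 0) =
          ∑ o, if componentB W o.1 = v then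
            (if ∃ y', componentB W y' = v ∧ f y' then W.prob x o else 0) else 0 := by
        intro v
        rw [commonChannel_prob_eq]
        split_ifs <;> simp
      simp_rw [h1]
      rw [Finset.sum_comm]
      refine Finset.sum_congr rfl fun o _ => ?_
      rw [Finset.sum_ite_eq, if_pos (Finset.mem_univ _)]
      exact if_congr (hf o.1) rfl rfl
    rw [hsum, hsum, hW a b, sub_self]
    exact mul_nonneg (inv_nonneg.2 hw.le)
      (Finset.sum_nonneg fun x _ => Finset.sum_nonneg fun o _ => hnn x o)
  · push Not at hall
    obtain ⟨x, o, hpos, hne⟩ := hall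
    -- One edge of disagreement already makes the right-hand side at least `1`, while a difference
    -- of probabilities is at most `1`.
    have h1 : w ≤ ∑ x, ∑ o, if f o.1 ↔ g o.2 then 0 else W.prob x o := by
      refine (hmin x o hpos).trans ?_
      refine le_trans (le_trans (le_of_eq ?_) (Finset.single_le_sum
        (f := fun o => if f o.1 ↔ g o.2 then 0 else W.prob x o)
        (fun o _ => hnn x o) (Finset.mem_univ o)))
        (Finset.single_le_sum (f := fun x => ∑ o, if f o.1 ↔ g o.2 then 0 else W.prob x o)
          (fun x _ => Finset.sum_nonneg fun o _ => hnn x o) (Finset.mem_univ x))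
      rw [if_neg (by tauto)]
    have h2 : (1 : ℝ) ≤ w⁻¹ * ∑ x, ∑ o, if f o.1 ↔ g o.2 then 0 else W.prob x o := by
      rw [← inv_mul_cancel₀ hw.ne']
      exact mul_le_mul_of_nonneg_left h1 (inv_nonneg.2 hw.le)
    refine le_trans ?_ h2
    have h3 : (∑ o, if f o.1 then W.prob a o else 0) ≤ 1 := by
      rw [← W.sum_eq_one a]
      refine Finset.sum_le_sum fun o _ => ?_
      have := W.nonneg a o
      split_ifs <;> linarith
    have h4 : 0 ≤ ∑ o, if f o.1 then W.prob b o else 0 := by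
      refine Finset.sum_nonneg fun o _ => ?_
      have := W.nonneg b o
      split_ifs <;> linarith
    linarith

open Classical in
/-- Conditioning on the outputs at all positions other than `i`. -/
theorem prOut_update_eq (W : Channel X (Y × Z)) {n : ℕ} (x : Fin n → X) (i : Fin n) (a : X)
    (E : Set ((Fin n → Y) × (Fin n → Z))) :
    prOut W (Function.update x i a) E = ∑ r : {j // j ≠ i} → Y × Z,
      (∏ j : {j // j ≠ i}, W.prob (x j) (r j)) * ∑ o : Y × Z,
        if (fun j => if h : j = i then o.1 else (r ⟨j, h⟩).1,
          fun j => if h : j = i then o.2 else (r ⟨j, h⟩).2) ∈ E then W.prob a o else 0 := by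
  rw [prOut_eq_sum_pow, ← (Equiv.funSplitAt i (Y × Z)).symm.sum_comp, Fintype.sum_prod_type,
    Finset.sum_comm]
  refine Finset.sum_congr rfl fun r _ => ?_
  rw [Finset.mul_sum]
  refine Finset.sum_congr rfl fun o _ => ?_
  have h1 : (W.pow n).prob (Function.update x i a) ((Equiv.funSplitAt i (Y × Z)).symm (o, r)) =
      (∏ j : {j // j ≠ i}, W.prob (x j) (r j)) * W.prob a o := by
    change ∏ j, W.prob (Function.update x i a j)
      ((Equiv.funSplitAt i (Y × Z)).symm (o, r) j) = _
    rw [Fintype.prod_eq_mul_prod_subtype_ne _ i, mul_comm]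
    congr 1
    · refine Finset.prod_congr rfl fun j _ => ?_
      simp [Equiv.funSplitAt, Equiv.piSplitAt, j.2]
    · simp [Equiv.funSplitAt, Equiv.piSplitAt]
  have h2 : (fun j => ((Equiv.funSplitAt i (Y × Z)).symm (o, r) j).1) =
      fun j => if h : j = i then o.1 else (r ⟨j, h⟩).1 := by
    funext j
    by_cases h : j = i <;> simp [Equiv.funSplitAt, Equiv.piSplitAt, h]
  have h3 : (fun j => ((Equiv.funSplitAt i (Y × Z)).symm (o, r) j).2) =
      fun j => if h : j = i then o.2 else (r ⟨j, h⟩).2 := by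
    funext j
    by_cases h : j = i <;> simp [Equiv.funSplitAt, Equiv.piSplitAt, h]
  rw [h1, h2, h3, mul_ite, mul_zero]

/-- The outputs at the other positions have a law independent of the letter at `i`; the
single-letter bound applies for each of their values and is then averaged. -/
theorem prOut_update_sub_le [Fintype X] (W : Channel X (Y × Z))
    (hW : ∀ a b, (commonChannel W).prob a = (commonChannel W).prob b)
    {w : ℝ} (hw : 0 < w) (hmin : ∀ x o, 0 < W.prob x o → w ≤ W.prob x o)
    {n : ℕ} (f : (Fin n → Y) → Prop) (g : (Fin n → Z) → Prop) (x : Fin n → X) (i : Fin n)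
    (a b : X) :
    prOut W (Function.update x i a) {o | f o.1} - prOut W (Function.update x i b) {o | f o.1} ≤
      w⁻¹ * ∑ x', prOut W (Function.update x i x') {o | ¬ (f o.1 ↔ g o.2)} := by
  classical
  simp_rw [prOut_update_eq]
  rw [Finset.sum_comm, ← Finset.sum_sub_distrib, Finset.mul_sum]
  refine Finset.sum_le_sum fun r _ => ?_
  rw [← mul_sub, ← Finset.mul_sum, mul_left_comm]
  refine mul_le_mul_of_nonneg_left ?_ (Finset.prod_nonneg fun j _ => W.nonneg _ _)
  refine (sum_sub_sum_le_of_commonChannel_const W hW hw hmin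
    (fun y => f fun j => if h : j = i then y else (r ⟨j, h⟩).1)
    (fun z => g fun j => if h : j = i then z else (r ⟨j, h⟩).2) a b).trans (le_of_eq ?_)
  refine congrArg (w⁻¹ * ·) (Finset.sum_congr rfl fun x' _ => Finset.sum_congr rfl fun o _ => ?_)
  simp only [Set.mem_ofPred_eq]
  split_ifs <;> rfl

/-- If the common channel is constant, the output law of a decoder of a consensus code hardly
depends on the transmitted word. -/
theorem prOut_sub_prOut_le [Fintype X] (W : Channel X (Y × Z))
    (hW : ∀ a b, (commonChannel W).prob a = (commonChannel W).prob b)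
    {w : ℝ} (hw : 0 < w) (hmin : ∀ x o, 0 < W.prob x o → w ≤ W.prob x o)
    {n K : ℕ} (c : Code X Y Z n K) (m : Fin K) {δ : ℝ} (hδ : ∀ x, disagreement W c x ≤ δ)
    (x x' : Fin n → X) :
    prOut W x' {o | c.decB o.1 = some m} - prOut W x {o | c.decB o.1 = some m} ≤
      n * (w⁻¹ * (Fintype.card X * δ)) := by
  classical
  -- Hybrid argument: each step replaces one letter of `x` by that of `x'`. The intermediate words
  -- need not be codewords, so the disagreement bound for arbitrary input words is essential.
  have key : ∀ S : Finset (Fin n), prOut W (S.piecewise x' x) {o | c.decB o.1 = some m} -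
      prOut W x {o | c.decB o.1 = some m} ≤ S.card * (w⁻¹ * (Fintype.card X * δ)) := by
    intro S
    induction S using Finset.induction_on with
    | empty => simp
    | insert i S hi ih =>
      have h1 := prOut_update_sub_le W hW hw hmin (fun y => c.decB y = some m)
        (fun z => c.decC z = some m) (S.piecewise x' x) i (x' i) (S.piecewise x' x i)
      rw [Function.update_eq_self] at h1
      have h2 : w⁻¹ * ∑ u, prOut W (Function.update (S.piecewise x' x) i u)
          {o | ¬ (c.decB o.1 = some m ↔ c.decC o.2 = some m)} ≤
          w⁻¹ * (Fintype.card X * δ) := by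
        refine mul_le_mul_of_nonneg_left ?_ (inv_nonneg.2 hw.le)
        refine (Finset.sum_le_sum fun u _ => (prOut_mono W _ ?_).trans (hδ _)).trans
          (le_of_eq ?_)
        · intro o ho heq
          exact ho (by rw [heq])
        · simp
      rw [Finset.piecewise_insert, Finset.card_insert_of_notMem hi]
      push_cast
      linarith
  simpa using key Finset.univ

theorem achievable_le_zero_of_commonChannel_const [Fintype X] (W : Channel X (Y × Z))
    (hW : ∀ a b, (commonChannel W).prob a = (commonChannel W).prob b) {R : ℝ}
    (hR : Achievable W R) : R ≤ 0 := by
  by_contra! hpos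
  obtain ⟨-, ε, hε, hev⟩ := hR
  obtain ⟨w, hw, hmin⟩ := exists_pos_le_prob W
  obtain ⟨ht1, ht2⟩ := tendsto_two_rpow_neg_mul hε
  have ht3 := ht1.mul_const (w⁻¹ * Fintype.card X)
  rw [zero_mul] at ht3
  -- The three conditions give `δ < 1 / 4`, a total hybrid cost below `1 / 2`, and at least two
  -- messages. Comparing two codewords yields `1 - δ ≤ δ + cost`, which is impossible.
  obtain ⟨n, ⟨c, hc⟩, hn1, hn2, hn3⟩ := (hev.and ((ht2.eventually_lt_const
    (u := 1 / 4) (by norm_num)).and ((ht3.eventually_lt_const (u := 1 / 2) (by norm_num)).and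
      (Filter.eventually_ge_atTop ⌈R⁻¹⌉₊)))).exists
  have hK : 2 ≤ ⌊(2 : ℝ) ^ ((n : ℝ) * R)⌋₊ := by
    refine Nat.le_floor ?_
    have h1 : 1 ≤ (n : ℝ) * R := by
      rw [← inv_mul_cancel₀ hpos.ne']
      exact mul_le_mul_of_nonneg_right (Nat.ceil_le.1 hn3) hpos.le
    simpa using Real.rpow_le_rpow_of_exponent_le one_le_two h1
  generalize ⌊(2 : ℝ) ^ ((n : ℝ) * R)⌋₊ = K at c hc hK
  set δ : ℝ := (2 : ℝ) ^ (-((n : ℝ) * ε)) with hδ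
  have h0 := (honestError_le_errorProb W c ⟨0, by lia⟩).trans hc
  have h1 := (honestError_le_errorProb W c ⟨1, by lia⟩).trans hc
  rw [honestError] at h0 h1
  have h2 := prOut_sub_prOut_le W hW hw hmin c ⟨0, by lia⟩
    (fun x => (disagreement_le_errorProb W c x).trans hc) (c.enc ⟨1, by lia⟩) (c.enc ⟨0, by lia⟩)
  have h3 := prOut_mono W (c.enc ⟨0, by lia⟩)
    (E := {o | c.decB o.1 = some ⟨0, by lia⟩ ∧ c.decC o.2 = some ⟨0, by lia⟩})
    (F := {o | c.decB o.1 = some ⟨0, by lia⟩}) fun o ho => ho.1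
  have h4 := prOut_add_le_one W (c.enc ⟨1, by lia⟩)
    (E := {o | c.decB o.1 = some ⟨0, by lia⟩})
    (F := {o | c.decB o.1 = some ⟨1, by lia⟩ ∧ c.decC o.2 = some ⟨1, by lia⟩})
    (Set.disjoint_left.2 fun o ho ho' => by
      simpa using Option.some.inj (Eq.trans (Eq.symm ho) ho'.1))
  have h5 : (n : ℝ) * (w⁻¹ * (Fintype.card X * δ)) = n * δ * (w⁻¹ * Fintype.card X) := by ring
  linarith

theorem consensusCapacity_eq_zero_of_commonChannel_const [Fintype X] [Nonempty X]
    (W : Channel X (Y × Z)) (hW : ∀ a b, (commonChannel W).prob a = (commonChannel W).prob b) :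
    consensusCapacity W = 0 :=
  le_antisymm ((isLUB_consensusCapacity W).2 fun _ hR =>
    achievable_le_zero_of_commonChannel_const W hW hR)
    ((isLUB_consensusCapacity W).1 (achievable_zero W))

theorem capacity_le_consensusCapacity [Fintype X] [Nonempty X] (W : Channel X (Y × Z)) :
    capacity (commonChannel W) ≤ consensusCapacity W := by
  refine le_of_forall_lt_imp_le_of_dense fun R hR => ?_
  -- Negative rates are not achievable by definition, so they are compared with the achievable rate
  -- `0`.
  rcases lt_or_ge R 0 with h | h
  · exact h.le.trans ((isLUB_consensusCapacity W).1 (achievable_zero W))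
  · exact (isLUB_consensusCapacity W).1 (achievable_of_lt_capacity W h hR)

theorem effectiveAlphabet_eq_singleton [Nonempty X] (W : Channel X (Y × Z))
    (hW : ∀ a b, (commonChannel W).prob a = (commonChannel W).prob b)
    {U : Set X} (hU : IsEffectiveAlphabet W U) : ∃ u, U = {u} := by
  have hrange : Set.range (commonChannel W).prob =
      {(commonChannel W).prob (Classical.arbitrary X)} := by
    refine Set.eq_singleton_iff_unique_mem.2 ⟨⟨_, rfl⟩, ?_⟩
    rintro _ ⟨a, rfl⟩
    exact hW _ _
  rw [IsEffectiveAlphabet, hrange, convexHull_singleton, extremePoints_singleton] at hU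
  obtain ⟨u, hu, -⟩ := hU.surjOn (Set.mem_singleton _)
  exact ⟨u, Set.eq_singleton_iff_unique_mem.2 ⟨hu, fun v hv => hU.injOn hv hu (hW _ _)⟩⟩

end Broadcast

end Consensus

theorem mainTheorem3 {X Y Z : Type*} [Fintype X] [Nonempty X] [Fintype Y] [Fintype Z]
    (W : Consensus.Channel X (Y × Z)) :
    -- the supremum and the maximum that define the two capacities are genuine
    IsLUB {R | Consensus.Achievable W R} (Consensus.consensusCapacity W) ∧
    IsGreatest (Consensus.mutualInfoValues (Consensus.commonChannel W))
      (Consensus.capacity (Consensus.commonChannel W)) ∧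
    -- if the common channel has capacity zero, then `U` is a singleton and `C_Byz = 0`
    (Consensus.capacity (Consensus.commonChannel W) = 0 →
      (∀ U : Set X, Consensus.IsEffectiveAlphabet W U → ∃ u, U = {u}) ∧
        Consensus.consensusCapacity W = 0) ∧
    -- the capacity of the common channel is a lower bound
    Consensus.capacity (Consensus.commonChannel W) ≤ Consensus.consensusCapacity W ∧
    -- the equivalence
    (0 < Consensus.consensusCapacity W ↔
      0 < Consensus.capacity (Consensus.commonChannel W)) := by
  have hconst : Consensus.capacity (Consensus.commonChannel W) = 0 →
      ∀ a b, (Consensus.commonChannel W).prob a = (Consensus.commonChannel W).prob b :=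
    fun h => Consensus.prob_eq_of_capacity_eq_zero _ h
  have hle := Consensus.capacity_le_consensusCapacity W
  refine ⟨Consensus.isLUB_consensusCapacity W, Consensus.isGreatest_capacity _, fun h =>
    ⟨fun U hU => Consensus.effectiveAlphabet_eq_singleton W (hconst h) hU,
      Consensus.consensusCapacity_eq_zero_of_commonChannel_const W (hconst h)⟩, hle,
    fun h => ?_, fun h => h.trans_le hle⟩
  refine (Consensus.capacity_nonneg _).lt_of_ne fun h0 => h.ne' ?_
  exact Consensus.consensusCapacity_eq_zero_of_commonChannel_const W (hconst h0.symm)
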